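/- A rack is a set $R$ with a binary operation $\triangleright$ such that $a\triangleright(b\triangleright c)=(a\triangleright b)\triangleright(a\triangleright c)$ for all $a,b,c\in R$, and such that for all $a,b\in R$ there is a unique $c\in R$ with $a\triangleright c=b$. A subset $Q\subseteq R$ (possibly empty) is a subrack if it is a rack under the operation of $R$; let $\mathcal R(R)$ denote the set of subracks of $R$, ordered by inclusion. For positive integers $k\le n$ let $\Pi_{n,k}$ be the set of all set partitions of $\{1,\dots,n\}$ each of whose blocks has size $1$ or size at least $k$, ordered by refinement. For a finite poset $P$ with least element $\hat 0$ and greatest element $\hat 1$, the order complex $\Delta(P)$ is the simplicial complex of all chains of $P\setminus\{\hat 0,\hat 1\}$. Let $p$ be an odd prime, let $n$ be an integer with $p<n-2$, and let $R_{n,p}$ be the rack of all $p$-cycles in the alternating group $A_n$, with operation $a\triangleright b=aba^{-1}$. Then (the geometric realizations of) $\Delta(\mathcal R(R_{n,p}))$ and $\Delta(\Pi_{n,p})$ are homotopy equivalent. -/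

import Mathlib

/-! ### Subracks -/

/-- A subrack of a rack `R`: a (possibly empty) subset `Q` which is a rack under the operation
of `R`. Since self-distributivity is inherited by every subset, this says that every `a ∈ Q`
acts on `Q` as a bijection `Q → Q`. -/
structure Subrack (R : Type*) [Rack R] where
  carrier : Set R
  bijOn : ∀ a ∈ carrier, Set.BijOn (Shelf.act a) carrier carrier

namespace Subrack

variable {R : Type*} [Rack R]

theorem carrier_injective : Function.Injective (carrier : Subrack R → Set R) := by
  rintro ⟨Q, _⟩ ⟨Q', _⟩ h
  cases h
  rfl

/-- The poset of all subracks of `R`, ordered by inclusion. -/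
instance : PartialOrder (Subrack R) := PartialOrder.lift carrier carrier_injective

instance [Finite R] : Finite (Subrack R) := Finite.of_injective carrier carrier_injective

/-- A subrack is a rack under the restricted operation. -/
noncomputable instance (Q : Subrack R) : Rack Q.carrier where
  act a b := ⟨Shelf.act a.1 b.1, (Q.bijOn a.1 a.2).mapsTo b.2⟩
  self_distrib := Subtype.ext Shelf.self_distrib
  invAct a b := ⟨Rack.invAct a.1 b.1, by
    obtain ⟨c, hc, h⟩ := (Q.bijOn a.1 a.2).surjOn b.2
    rw [← h, Rack.invAct_act_eq]
    exact hc⟩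
  left_inv a b := Subtype.ext (Rack.invAct_act_eq a.1 b.1)
  right_inv a b := Subtype.ext (Rack.act_invAct_eq a.1 b.1)

end Subrack

/-- The rack of all `p`-cycles in the alternating group on `{0, …, n - 1}`, a subrack of that
group with the operation `a ▷ b = a * b * a⁻¹`. -/
def pCycleRack (n p : ℕ) : Subrack (Quandle.Conj (alternatingGroup (Fin n))) where
  carrier := {σ | (σ.1 : Equiv.Perm (Fin n)).IsCycle ∧ σ.1.support.card = p}
  bijOn := by
    have key : ∀ a b : alternatingGroup (Fin n), (b.1.IsCycle ∧ b.1.support.card = p) →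
        ((a * b * a⁻¹).1.IsCycle ∧ (a * b * a⁻¹).1.support.card = p) := by
      intro a b hb
      refine ⟨?_, ?_⟩
      · simpa using hb.1.conj (g := a.1)
      · simpa using hb.2
    intro a _
    refine ⟨fun b hb => key a b hb, fun b _ c _ h => (Rack.left_cancel a).1 h, fun b hb => ?_⟩
    refine ⟨Rack.invAct a b, ?_, Rack.act_invAct_eq a b⟩
    have h := key a⁻¹ b hb
    rw [inv_inv] at h
    exact h

/-! ### The `k`-equal partition lattice -/

/-- The set partitions of `{0, …, n - 1}` all of whose blocks have size `1` or size at least `k`,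
ordered by refinement (the order of `Finpartition`: `P ≤ P'` iff each block of `P` is contained
in a block of `P'`). -/
abbrev KEqualPartition (n k : ℕ) : Type :=
  {P : Finpartition (Finset.univ : Finset (Fin n)) // ∀ B ∈ P.parts, B.card = 1 ∨ k ≤ B.card}

/-! ### Order complexes and homotopy type -/

/-- The proper part of a poset: remove the least and the greatest element (when they exist). -/
abbrev ProperPart (P : Type*) [PartialOrder P] : Type _ :=
  {x : P // ¬ IsBot x ∧ ¬ IsTop x}

/-- The order complex of a poset `P` with least and greatest element: the abstract simplicial
complex on the proper part of `P` whose faces are the nonempty finite chains. -/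
def orderComplex (P : Type*) [PartialOrder P] : AbstractSimplicialComplex (ProperPart P) where
  faces := {s | s.Nonempty ∧ IsChain (· ≤ ·) (s : Set (ProperPart P))}
  isRelLowerSet_faces := fun _ hs =>
    ⟨hs.1, fun _ hts ht => ⟨ht, hs.2.mono (Finset.coe_subset.2 hts)⟩⟩
  singleton_mem v := ⟨Finset.singleton_nonempty v, by simp⟩

/-- The geometric realization of an abstract simplicial complex on a finite vertex set `V`, in
barycentric coordinates: the points of `V → ℝ` lying in the standard simplex spanned by some
face. It carries the subspace topology of the finite-dimensional real vector space `V → ℝ`. -/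
def geometricRealization {V : Type*} [Finite V] (K : AbstractSimplicialComplex V) :
    Set (V → ℝ) :=
  {w | (∀ v, 0 ≤ w v) ∧ ∃ s ∈ K, (∀ v, v ∉ s → w v = 0) ∧ ∑ v ∈ s, w v = 1}

/-- Two finite posets have homotopy equivalent order complexes: the geometric realizations of
their order complexes are homotopy equivalent topological spaces. -/
def OrderComplexesHomotopyEquivalent (P Q : Type*) [PartialOrder P] [PartialOrder Q]
    [Finite P] [Finite Q] : Prop :=
  Nonempty (ContinuousMap.HomotopyEquiv
    (geometricRealization (orderComplex P)) (geometricRealization (orderComplex Q)))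

/-! Send a subrack `Q` to the partition into orbits of the group it generates, and a partition to
the subrack of all `p`-cycles preserving each of its blocks. Both maps are monotone. Partition to
subrack and back is the identity, since any two points of a block of size at least `p` lie on a
common `p`-cycle inside it, while subrack to partition and back can only enlarge `Q`. The image of
the partitions is therefore the set of closed elements of a closure operator on subracks, and
retracting a finite poset onto its closed elements preserves the homotopy type of the order complex
(`of_closure`).

The retraction must respect proper parts: only the full subrack may have a single orbit
(`eq_univ_of_isPretransitive`). A transitive group generated by `p`-cycles is primitive
(`isPreprimitive_closure`). Since a `p`-cycle in it fixes at least three points, it contains the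
alternating group by a theorem of Jordan (`alternatingGroup_le_of_isPreprimitive_of_isCycle_mem`),
under which all `p`-cycles are conjugate. -/

/-! ### Order complexes and closure operators. -/

section MoveMass

variable {V : Type*}

open Classical in
/-- Move the proportion `t` of the mass at `x` to `y`. -/
noncomputable def moveMass (x y : V) (t : ℝ) (w : V → ℝ) : V → ℝ :=
  fun v => w v + t * w x * ((if v = y then 1 else 0) - if v = x then 1 else 0)

theorem continuous_moveMass (x y : V) :
    Continuous fun q : ℝ × (V → ℝ) => moveMass x y q.1 q.2 := by
  unfold moveMass
  fun_prop

theorem moveMass_zero (x y : V) (w : V → ℝ) : moveMass x y 0 w = w := by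
  ext v
  simp [moveMass]

theorem moveMass_of_eq_zero (x y : V) (t : ℝ) {w : V → ℝ} (h : w x = 0) :
    moveMass x y t w = w := by
  ext v
  simp [moveMass, h]

end MoveMass

section ChainRealization

variable {V : Type*} [PartialOrder V] [Fintype V]

/-- The points, in barycentric coordinates, of the geometric realization of the order complex of
the subposet `S` of a finite poset `V`. -/
def chainRealization (S : Set V) : Set (V → ℝ) :=
  {w | (∀ v, 0 ≤ w v) ∧ Function.support w ⊆ S ∧ IsChain (· ≤ ·) (Function.support w) ∧
    ∑ v, w v = 1}

theorem geometricRealization_orderComplex (P : Type*) [PartialOrder P] [Finite P]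
    [Fintype (ProperPart P)] :
    geometricRealization (orderComplex P) = chainRealization (Set.univ : Set (ProperPart P)) := by
  classical
  ext w
  constructor
  · rintro ⟨h0, s, hs, hsup, hsum⟩
    have hss : Function.support w ⊆ s := fun v hv => by
      by_contra h
      exact hv (hsup v h)
    refine ⟨h0, Set.subset_univ _, IsChain.mono hss hs.2, ?_⟩
    rw [← hsum]
    exact (Finset.sum_subset (Finset.subset_univ _) fun v _ hv => hsup v hv).symm
  · rintro ⟨h0, -, hc, hsum⟩
    refine ⟨h0, Finset.univ.filter (fun v => w v ≠ 0), ⟨?_, ?_⟩, ?_, ?_⟩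
    · by_contra h
      rw [Finset.not_nonempty_iff_eq_empty] at h
      have : ∑ v, w v = 0 := Finset.sum_eq_zero fun v _ => by
        by_contra hv
        have : v ∈ Finset.univ.filter (fun v => w v ≠ 0) := by simp [hv]
        simp [h] at this
      linarith
    · refine hc.mono fun v hv => ?_
      simpa using hv
    · intro v hv
      simpa using hv
    · rw [← hsum]
      exact Finset.sum_subset (Finset.subset_univ _) fun v _ hv => by simpa using hv

/-- A chain in `S` through `x` stays a chain when `y` is added: its members above `x` are above `y`
by `hb`, and the others are below `x`, hence below `y`. -/
theorem moveMass_mem {S : Set V} {x y : V} (hy : y ∈ S) (hxy : x < y)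
    (hb : ∀ z ∈ S, x < z → y ≤ z) {t : ℝ} (ht0 : 0 ≤ t) (ht1 : t ≤ 1) {w : V → ℝ}
    (hw : w ∈ chainRealization S) : moveMass x y t w ∈ chainRealization S := by
  classical
  obtain ⟨h0, hS, hc, hs⟩ := hw
  by_cases hx : w x = 0
  · rw [moveMass_of_eq_zero _ _ _ hx]
    exact ⟨h0, hS, hc, hs⟩
  have hsub : Function.support (moveMass x y t w) ⊆ insert y (Function.support w) := by
    intro v hv
    by_contra h
    simp only [Set.mem_insert_iff, Function.mem_support, not_or, not_not] at h
    apply hv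
    have : v ≠ x := by
      rintro rfl
      exact hx h.2
    simp [moveMass, h, this]
  refine ⟨fun v => ?_, hsub.trans (Set.insert_subset hy hS), IsChain.mono hsub ?_, ?_⟩
  · have h1 : 0 ≤ t * w x := mul_nonneg ht0 (h0 x)
    have h2 : t * w x ≤ w x := mul_le_of_le_one_left (h0 x) ht1
    have h3 := h0 v
    unfold moveMass
    by_cases hvy : v = y
    · subst hvy
      simp only [if_true, hxy.ne', if_false]
      linarith
    · by_cases hvx : v = x
      · subst hvx
        simp only [if_true, hvy, if_false]
        linarith
      · simp only [hvx, hvy, if_false]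
        linarith
  · refine hc.insert fun z hz _ => ?_
    rcases eq_or_ne x z with rfl | hne
    · exact Or.inr hxy.le
    · rcases hc (show x ∈ Function.support w from hx) hz hne with h | h
      · exact Or.inl (hb z (hS hz) (lt_of_le_of_ne h hne))
      · exact Or.inr (h.trans hxy.le)
  · simp only [moveMass, Finset.sum_add_distrib, ← Finset.mul_sum, Finset.sum_sub_distrib]
    simp [hs]

theorem moveMass_one_mem {S : Set V} {x y : V} (hy : y ∈ S) (hxy : x < y)
    (hb : ∀ z ∈ S, x < z → y ≤ z) {w : V → ℝ}
    (hw : w ∈ chainRealization S) : moveMass x y 1 w ∈ chainRealization (S \ {x}) := by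
  obtain ⟨h0, hS, h⟩ := moveMass_mem hy hxy hb zero_le_one le_rfl hw
  refine ⟨h0, fun v hv => ⟨hS hv, ?_⟩, h⟩
  rintro rfl
  exact hv (by simp [moveMass, hxy.ne])

theorem chainRealization_mono {S T : Set V} (h : S ⊆ T) :
    chainRealization S ⊆ chainRealization T :=
  fun _ hw => ⟨hw.1, hw.2.1.trans h, hw.2.2⟩

/-- Removing an up-beat point from a finite poset does not change the homotopy type of its order
complex. -/
noncomputable def homotopyEquivOfUpBeat {S : Set V} {x y : V} (hy : y ∈ S) (hxy : x < y)
    (hb : ∀ z ∈ S, x < z → y ≤ z) :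
    ContinuousMap.HomotopyEquiv (chainRealization S) (chainRealization (S \ {x})) where
  toFun := ⟨fun w => ⟨moveMass x y 1 w, moveMass_one_mem hy hxy hb w.2⟩, by
    refine Continuous.subtype_mk ?_ _
    exact (continuous_moveMass x y).comp (by fun_prop : Continuous fun w : chainRealization S =>
      ((1 : ℝ), (w : V → ℝ)))⟩
  invFun := ⟨fun w => ⟨w, chainRealization_mono Set.sdiff_subset w.2⟩, by fun_prop⟩
  left_inv := by
    refine ContinuousMap.Homotopic.symm ⟨?_⟩
    refine
      { toFun := fun q => ⟨moveMass x y q.1 q.2, moveMass_mem hy hxy hb q.1.2.1 q.1.2.2 q.2.2⟩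
        continuous_toFun := ?_
        map_zero_left := ?_
        map_one_left := ?_ }
    · refine Continuous.subtype_mk ?_ _
      exact (continuous_moveMass x y).comp
        (by fun_prop : Continuous fun q : unitInterval × chainRealization S =>
          ((q.1 : ℝ), (q.2 : V → ℝ)))
    · intro w
      ext1
      exact moveMass_zero x y w
    · intro w
      rfl
  right_inv := by
    have : ∀ w : chainRealization (S \ {x}), (w : V → ℝ) x = 0 := fun w => by
      by_contra h
      exact (w.2.2.1 h).2 rfl
    convert ContinuousMap.Homotopic.refl _
    ext1 w
    ext1
    exact (moveMass_of_eq_zero x y 1 (this w)).symm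

/-- Non-closed points are removed one at a time, maximal ones first. Everything remaining above such
an `x` is closed, so `c x` is the least remaining element above `x`, and `x` is an up-beat point. -/
theorem nonempty_homotopyEquiv_fixedPoints {c : V → V} (hc : Monotone c) (hle : ∀ x, x ≤ c x)
    (hcc : ∀ x, c (c x) = c x) :
    Nonempty (ContinuousMap.HomotopyEquiv (chainRealization (Set.univ : Set V))
      (chainRealization (Function.fixedPoints c))) := by
  suffices H : ∀ k : ℕ, ∀ S : Set V, Function.fixedPoints c ⊆ S →
      (S \ Function.fixedPoints c).ncard = k →
      Nonempty (ContinuousMap.HomotopyEquiv (chainRealization S)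
        (chainRealization (Function.fixedPoints c))) from H _ _ (Set.subset_univ _) rfl
  intro k
  induction k with
  | zero =>
    intro S hS hk
    rw [Set.ncard_eq_zero (Set.toFinite _), Set.sdiff_eq_empty] at hk
    rw [hS.antisymm hk]
    exact ⟨ContinuousMap.HomotopyEquiv.refl _⟩
  | succ k ih =>
    intro S hS hk
    have hne : (S \ Function.fixedPoints c).Nonempty := by
      rw [← Set.ncard_pos (Set.toFinite _)]
      omega
    obtain ⟨x, hx⟩ := (Set.toFinite (S \ Function.fixedPoints c)).exists_maximal hne
    have hxy : x < c x := lt_of_le_of_ne (hle x) fun h => hx.prop.2 h.symm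
    have hb : ∀ z ∈ S, x < z → c x ≤ z := by
      intro z hz hxz
      have hzc : c z = z := by
        by_contra h
        exact hx.not_prop_of_gt hxz ⟨hz, h⟩
      rw [← hzc]
      exact hc hxz.le
    obtain ⟨e⟩ := ih (S \ {x}) (fun z hz => ⟨hS hz, fun h => hx.prop.2 (h ▸ hz)⟩) (by
      rw [Set.sdiff_sdiff_comm, Set.ncard_sdiff_singleton_of_mem hx.prop, hk]
      rfl)
    exact ⟨(homotopyEquivOfUpBeat (hS (hcc x)) hxy hb).trans e⟩

open Classical in
/-- The realization of the subposet of points fixed by `g ∘ f`, where `f ∘ g = id`, is the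
realization of the source of `g`. -/
noncomputable def homeomorphFixedPoints {W : Type*} [PartialOrder W] [Fintype W] {f : V → W}
    {g : W → V} (hf : Monotone f) (hg : Monotone g) (hfg : ∀ y, f (g y) = y) :
    chainRealization (Function.fixedPoints (g ∘ f)) ≃ₜ
      chainRealization (Set.univ : Set W) where
  toFun w := ⟨fun y => w.1 (g y), fun y => w.2.1 _, Set.subset_univ _, by
    intro a ha b hb hab
    have := w.2.2.2.1 ha hb fun h => hab (by rw [← hfg a, h, hfg])
    refine this.imp (fun h => ?_) (fun h => ?_)
    · simpa only [hfg] using hf h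
    · simpa only [hfg] using hf h, by
    rw [← w.2.2.2.2]
    refine Finset.sum_of_injOn g (fun a _ b _ h => by rw [← hfg a, h, hfg]) (by simp) ?_ (by simp)
    intro v _ hv
    by_contra h
    exact hv ⟨f v, by simp, w.2.2.1 h⟩⟩
  invFun u := ⟨fun x => if g (f x) = x then u.1 (f x) else 0, by
    intro x
    dsimp only
    split_ifs
    exacts [u.2.1 _, le_rfl], by
    intro x hx
    by_contra h
    exact hx (if_neg h), by
    intro a ha b hb hab
    have key : ∀ x, x ∈ Function.support (fun x => if g (f x) = x then u.1 (f x) else 0) →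
        g (f x) = x ∧ f x ∈ Function.support u.1 := by
      intro x hx
      by_cases h : g (f x) = x
      · exact ⟨h, by simpa [h] using hx⟩
      · exact absurd (if_neg h) hx
    obtain ⟨ha1, ha2⟩ := key a ha
    obtain ⟨hb1, hb2⟩ := key b hb
    have := u.2.2.2.1 ha2 hb2 fun h => hab (by rw [← ha1, h, hb1])
    refine this.imp (fun h => ?_) (fun h => ?_)
    · simpa only [ha1, hb1] using hg h
    · simpa only [ha1, hb1] using hg h, by
    rw [← u.2.2.2.2]
    symm
    refine Finset.sum_of_injOn g (fun a _ b _ h => by rw [← hfg a, h, hfg]) (by simp) ?_ ?_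
    · intro v _ hv
      refine if_neg fun h => hv ⟨f v, by simp, h⟩
    · intro y _
      simp [hfg]⟩
  left_inv w := by
    ext x
    dsimp only
    split_ifs with h
    · rw [h]
    · by_contra h'
      exact h (w.2.2.1 (Ne.symm h'))
  right_inv u := by
    ext y
    simp [hfg]
  continuous_toFun := by
    exact Continuous.subtype_mk
      (continuous_pi fun y => (continuous_apply (A := fun _ : V => ℝ) (g y)).comp
        continuous_subtype_val) _
  continuous_invFun := by
    refine Continuous.subtype_mk (continuous_pi fun x => ?_) _
    by_cases h : g (f x) = x
    · simp only [h, if_true]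
      exact (continuous_apply (A := fun _ : W => ℝ) (f x)).comp continuous_subtype_val
    · simp only [h, if_false]
      exact continuous_const

end ChainRealization

/-- The composite `g ∘ f` is a closure operator whose closed elements form a copy of `Y`. The
conditions `hbot` and `htop` let `f` restrict to proper parts; for `g` this follows from `hfg`. -/
theorem OrderComplexesHomotopyEquivalent.of_closure {X Y : Type*} [PartialOrder X]
    [PartialOrder Y] [Finite X] [Finite Y] {f : X → Y} {g : Y → X} (hf : Monotone f)
    (hg : Monotone g) (hfg : ∀ y, f (g y) = y) (hgf : ∀ x, x ≤ g (f x))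
    (hbot : ∀ x, IsBot (f x) → IsBot x) (htop : ∀ x, IsTop (f x) → IsTop x) :
    OrderComplexesHomotopyEquivalent X Y := by
  have := Fintype.ofFinite (ProperPart X)
  have := Fintype.ofFinite (ProperPart Y)
  unfold OrderComplexesHomotopyEquivalent
  rw [geometricRealization_orderComplex, geometricRealization_orderComplex]
  let f' : ProperPart X → ProperPart Y := fun x =>
    ⟨f x, fun h => x.2.1 (hbot _ h), fun h => x.2.2 (htop _ h)⟩
  let g' : ProperPart Y → ProperPart X := fun y =>
    ⟨g y, fun h => y.2.1 fun z => by simpa only [hfg] using hf (h (g z)),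
      fun h => y.2.2 fun z => by simpa only [hfg] using hf (h (g z))⟩
  have hf' : Monotone f' := fun a b h => hf h
  have hg' : Monotone g' := fun a b h => hg h
  have hfg' : ∀ y, f' (g' y) = y := fun y => Subtype.ext (hfg y)
  obtain ⟨e⟩ := nonempty_homotopyEquiv_fixedPoints (c := g' ∘ f') (hg'.comp hf')
    (fun x => hgf x.1) (fun x => by simp [hfg'])
  exact ⟨e.trans (homeomorphFixedPoints hf' hg' hfg').toHomotopyEquiv⟩

/-! ### Permutation groups containing cycles of prime length. -/

/-- Both cyclic groups are Sylow `p`-subgroups of `K`, hence conjugate. -/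
theorem exists_conj_mem_zpowers_of_orderOf_eq {K : Type*} [Group K] [Finite K] {p : ℕ}
    (hp : p.Prime) (hK : (Nat.card K).factorization p = 1) {u v : K} (hu : orderOf u = p)
    (hv : orderOf v = p) : ∃ k : K, k * v * k⁻¹ ∈ Subgroup.zpowers u := by
  have := Fact.mk hp
  let P := Sylow.ofCard (p := p) (Subgroup.zpowers u) (by rw [Nat.card_zpowers, hu, hK, pow_one])
  let Q := Sylow.ofCard (p := p) (Subgroup.zpowers v) (by rw [Nat.card_zpowers, hv, hK, pow_one])
  obtain ⟨k, hk⟩ := MulAction.exists_smul_eq K Q P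
  refine ⟨k, ?_⟩
  have h1 : (P : Subgroup K) = Subgroup.zpowers u := rfl
  have h2 : (Q : Subgroup K) = Subgroup.zpowers v := rfl
  rw [← h1, ← hk, Sylow.coe_subgroup_smul, h2]
  exact Subgroup.smul_mem_pointwise_smul v (MulAut.conj k) _ (Subgroup.mem_zpowers v)

theorem Nat.Prime.not_sq_dvd_factorial {p : ℕ} (hp : p.Prime) : ¬ p ^ 2 ∣ p.factorial := by
  obtain ⟨q, rfl⟩ := Nat.exists_eq_succ_of_ne_zero hp.ne_zero
  rw [Nat.factorial_succ, pow_two]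
  intro h
  have := Nat.dvd_of_mul_dvd_mul_left hp.pos h
  rw [hp.dvd_factorial] at this
  omega

namespace Equiv.Perm

open scoped Pointwise

variable {α : Type*} [Fintype α] [DecidableEq α]

theorem card_fixingSubgroup_compl (s : Finset α) :
    Nat.card (fixingSubgroup (Equiv.Perm α) ((s : Set α)ᶜ)) = s.card.factorial := by
  have e : Equiv.Perm {a // a ∈ s} ≃ fixingSubgroup (Equiv.Perm α) ((s : Set α)ᶜ) :=
    (Equiv.Perm.subtypeEquivSubtypePerm (· ∈ s)).trans
      (Equiv.subtypeEquivRight fun f => by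
        simp [mem_fixingSubgroup_iff])
  rw [← Nat.card_congr e, Nat.card_perm]
  simp

/-- Frattini argument: if `g` permutes the fixed points of a `p`-cycle `x` of a group `G`, then
some element of `G` normalizing `x` acts on these fixed points like `g`. -/
theorem exists_mem_conj_mem_zpowers {G : Subgroup (Equiv.Perm α)} {x : Equiv.Perm α} {p : ℕ}
    (hp : p.Prime) (hx : x.IsCycle) (hxp : x.support.card = p) (hxG : x ∈ G) {g : Equiv.Perm α}
    (hg : g ∈ G) (hgx : ∀ a, a ∉ x.support → g a ∉ x.support) :
    ∃ h ∈ G, (∀ a, a ∉ x.support → h a = g a) ∧ h * x * h⁻¹ ∈ Subgroup.zpowers x := by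
  set K : Subgroup (Equiv.Perm α) :=
    G ⊓ fixingSubgroup (Equiv.Perm α) ((x.support : Set α)ᶜ) with hKdef
  have hmem : ∀ k, k ∈ K ↔ k ∈ G ∧ ∀ a, a ∉ x.support → k a = a := by
    intro k
    simp [hKdef, mem_fixingSubgroup_iff]
  have hxK : x ∈ K := (hmem x).2 ⟨hxG, fun a ha => by simpa using ha⟩
  have hgmem : ∀ a, g⁻¹ a ∈ x.support → a ∈ x.support := by
    have hinj : Set.MapsTo g ((x.supportᶜ : Finset α) : Set α) ((x.supportᶜ : Finset α) : Set α) :=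
      fun a ha => by simpa using hgx a (by simpa using ha)
    have hsurj := Finset.surjOn_of_injOn_of_card_le g hinj g.injective.injOn le_rfl
    intro a ha
    by_contra hna
    obtain ⟨b, hb, rfl⟩ := hsurj (show a ∈ ((x.supportᶜ : Finset α) : Set α) by simpa using hna)
    rw [← Equiv.Perm.mul_apply, inv_mul_cancel, Equiv.Perm.one_apply] at ha
    simp only [Finset.coe_compl, Set.mem_compl_iff, Finset.mem_coe] at hb
    exact hb ha
  have hyK : g * x * g⁻¹ ∈ K := by
    refine (hmem _).2 ⟨G.mul_mem (G.mul_mem hg hxG) (G.inv_mem hg), fun a ha => ?_⟩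
    have : x (g⁻¹ a) = g⁻¹ a := by
      rw [← Equiv.Perm.notMem_support]
      exact fun h => ha (hgmem a h)
    simp only [Equiv.Perm.mul_apply, this]
    rw [← Equiv.Perm.mul_apply, mul_inv_cancel, Equiv.Perm.one_apply]
  have hord : orderOf x = p := by rw [hx.orderOf, hxp]
  have hordy : orderOf (g * x * g⁻¹) = p := by
    rw [(hx.conj (g := g)).orderOf, Equiv.Perm.card_support_conj, hxp]
  -- `K` moves only the `p` points of the support, so its order divides `p!`, in which `p` occurs
  -- exactly once.
  have hcard : (Nat.card K).factorization p = 1 := by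
    refine le_antisymm ?_ ?_
    · by_contra! h
      have h2 : p ^ 2 ∣ Nat.card K :=
        (hp.pow_dvd_iff_le_factorization Nat.card_pos.ne').2 h
      have h3 : Nat.card K ∣ p.factorial := by
        rw [← hxp, ← card_fixingSubgroup_compl]
        exact Subgroup.card_dvd_of_le inf_le_right
      exact hp.not_sq_dvd_factorial (h2.trans h3)
    · refine (hp.dvd_iff_one_le_factorization Nat.card_pos.ne').1 ?_
      have := orderOf_dvd_natCard (⟨x, hxK⟩ : K)
      rwa [Subgroup.orderOf_mk, hord] at this
  obtain ⟨k, hk⟩ := exists_conj_mem_zpowers_of_orderOf_eq hp hcard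
    (u := (⟨x, hxK⟩ : K)) (v := ⟨_, hyK⟩) (by rw [Subgroup.orderOf_mk, hord])
    (by rw [Subgroup.orderOf_mk, hordy])
  obtain ⟨hkG, hkfix⟩ := (hmem k).1 k.2
  refine ⟨k * g, G.mul_mem hkG hg, fun a ha => hkfix _ (hgx a ha), ?_⟩
  obtain ⟨i, hi⟩ := Subgroup.mem_zpowers_iff.1 hk
  refine Subgroup.mem_zpowers_iff.2 ⟨i, ?_⟩
  have := congrArg Subtype.val hi
  simp only [Subgroup.coe_zpow, Subgroup.coe_mul, Subgroup.coe_inv] at this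
  rw [this]
  group

/-- An element commuting with a cycle `x` acts on the support of `x` as a power of `x`. -/
theorem IsCycle.exists_zpow_eq_of_commute {x y : Equiv.Perm α} (hx : x.IsCycle)
    (hxy : Commute y x) : ∃ j : ℤ, ∀ a ∈ x.support, y a = (x ^ j) a := by
  obtain ⟨a, ha, hxa⟩ := hx
  have hya : x (y a) ≠ y a := by
    have : x (y a) = y (x a) := (DFunLike.congr_fun hxy.eq a).symm
    rw [this]
    exact fun h => ha (y.injective h)
  obtain ⟨j, hj⟩ := hxa hya
  refine ⟨j, fun b hb => ?_⟩
  obtain ⟨i, rfl⟩ := hxa (Equiv.Perm.mem_support.1 hb)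
  have h1 : y ((x ^ i) a) = (x ^ i) (y a) := DFunLike.congr_fun (hxy.zpow_right i).eq a
  rw [h1, ← hj, ← Equiv.Perm.mul_apply, ← Equiv.Perm.mul_apply, ← zpow_add, ← zpow_add, add_comm]

/-- Conjugation by `h` and by `k` raises `x` to powers `i` and `j`; exponents commute, so `h * k`
and `k * h` conjugate `x` to the same element. -/
theorem _root_.commute_inv_mul_of_conj_mem_zpowers {G : Type*} [Group G] {x h k : G}
    (hh : h * x * h⁻¹ ∈ Subgroup.zpowers x) (hk : k * x * k⁻¹ ∈ Subgroup.zpowers x) :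
    Commute ((k * h)⁻¹ * (h * k)) x := by
  obtain ⟨i, hi⟩ := Subgroup.mem_zpowers_iff.1 hh
  obtain ⟨j, hj⟩ := Subgroup.mem_zpowers_iff.1 hk
  have e1 : (h * k) * x * (h * k)⁻¹ = x ^ (i * j) := by
    calc (h * k) * x * (h * k)⁻¹ = h * (k * x * k⁻¹) * h⁻¹ := by group
      _ = (h * x * h⁻¹) ^ j := by rw [← hj, conj_zpow]
      _ = x ^ (i * j) := by rw [← hi, zpow_mul]
  have e2 : (k * h) * x * (k * h)⁻¹ = x ^ (i * j) := by
    calc (k * h) * x * (k * h)⁻¹ = k * (h * x * h⁻¹) * k⁻¹ := by group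
      _ = (k * x * k⁻¹) ^ i := by rw [← hi, conj_zpow]
      _ = x ^ (i * j) := by rw [← hj, ← zpow_mul, mul_comm]
  calc (k * h)⁻¹ * (h * k) * x = (k * h)⁻¹ * ((h * k) * x * (h * k)⁻¹) * (h * k) := by group
    _ = (k * h)⁻¹ * ((k * h) * x * (k * h)⁻¹) * (h * k) := by rw [e1, e2]
    _ = x * ((k * h)⁻¹ * (h * k)) := by group

/-- A primitive permutation group containing a cycle of prime length fixing at least three points
contains the alternating group (Jordan). -/
theorem alternatingGroup_le_of_isPreprimitive_of_isCycle_mem {G : Subgroup (Equiv.Perm α)}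
    (hG : MulAction.IsPreprimitive G α) {x : Equiv.Perm α} {p : ℕ} (hp : p.Prime)
    (hx : x.IsCycle) (hxp : x.support.card = p) (hxG : x ∈ G) (hcard : p + 2 < Fintype.card α) :
    alternatingGroup α ≤ G := by
  have hcompl : ((x.support : Set α)ᶜ).ncard = Fintype.card α - p := by
    rw [← Finset.coe_compl, Set.ncard_coe_finset, Finset.card_compl, hxp]
  have htwo := hp.two_le
  have htrans := isPretransitive_of_isCycle_mem hx hxG
  have hprim : MulAction.IsPreprimitive (fixingSubgroup G (x.support : Set α)ᶜ)
      (SubMulAction.ofFixingSubgroup G (x.support : Set α)ᶜ) := by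
    refine MulAction.IsPreprimitive.of_prime_card ?_
    have : Nat.card (SubMulAction.ofFixingSubgroup G (x.support : Set α)ᶜ) = p := by
      have h1 : Nat.card (SubMulAction.ofFixingSubgroup G (x.support : Set α)ᶜ) =
          ((x.support : Set α)ᶜᶜ).ncard := rfl
      rw [h1, compl_compl, Set.ncard_coe_finset, hxp]
    rwa [this]
  -- Jordan's criterion gives one degree of transitivity more than the number of fixed points of
  -- `x`; only that number is needed, to permute the fixed points arbitrarily.
  have hmul : MulAction.IsMultiplyPretransitive G α (Fintype.card α - p - 1 + 2) :=
    (hG.isMultiplyPreprimitive (n := Fintype.card α - p - 1) (by rw [hcompl]; omega)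
      (by rw [Nat.card_eq_fintype_card]; omega) hprim).isMultiplyPretransitive
  have hmul' : MulAction.IsMultiplyPretransitive G α (Fintype.card α - p) :=
    MulAction.isMultiplyPretransitive_of_le (n := Fintype.card α - p - 1 + 2) (by omega)
      (by rw [Nat.card_eq_fintype_card]; omega)
  have hswap : ∀ a b, a ∉ x.support → b ∉ x.support → ∀ c, c ∉ x.support →
      swap a b c ∉ x.support := by
    intro a b ha hb c hc
    rw [swap_apply_def]
    split_ifs <;> assumption
  have key : ∀ a b, a ∉ x.support → b ∉ x.support → ∃ h ∈ G,
      (∀ c, c ∉ x.support → h c = swap a b c) ∧ h * x * h⁻¹ ∈ Subgroup.zpowers x := by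
    intro a b ha hb
    let e : Fin (Fintype.card α - p) ≃ (x.supportᶜ : Finset α) :=
      (Finset.equivFinOfCardEq (by rw [Finset.card_compl, hxp])).symm
    let u : Fin (Fintype.card α - p) ↪ α := e.toEmbedding.trans (Function.Embedding.subtype _)
    obtain ⟨g, hg⟩ := MulAction.isMultiplyPretransitive_iff.1 hmul' u
      (u.trans (swap a b).toEmbedding)
    have hgswap : ∀ c, c ∉ x.support → g.1 c = swap a b c := by
      intro c hc
      have := DFunLike.congr_fun hg (e.symm ⟨c, by simpa using hc⟩)
      simpa [u, Subgroup.smul_def] using this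
    obtain ⟨h, hhG, hh, hhx⟩ := exists_mem_conj_mem_zpowers hp hx hxp hxG g.2
      (fun c hc => hgswap c hc ▸ hswap a b ha hb c hc)
    exact ⟨h, hhG, fun c hc => (hh c hc).trans (hgswap c hc), hhx⟩
  obtain ⟨a, b, c, ha, hb, hc, hab, hac, hbc⟩ : ∃ a b c, a ∈ x.supportᶜ ∧ b ∈ x.supportᶜ ∧
      c ∈ x.supportᶜ ∧ a ≠ b ∧ a ≠ c ∧ b ≠ c :=
    Finset.two_lt_card_iff.1 (by rw [Finset.card_compl, hxp]; omega)
  rw [Finset.mem_compl] at ha hb hc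
  obtain ⟨h, hhG, hh, hhx⟩ := key a b ha hb
  obtain ⟨k, hkG, hk, hkx⟩ := key a c ha hc
  have hinv : ∀ a b, a ∉ x.support → b ∉ x.support → ∀ h : Equiv.Perm α,
      (∀ c, c ∉ x.support → h c = swap a b c) → ∀ c, c ∉ x.support → h⁻¹ c = swap a b c := by
    intro a b ha hb h hh c hc
    rw [Equiv.Perm.inv_eq_iff_eq, hh _ (hswap a b ha hb c hc), swap_apply_self]
  have hyG : (k * h)⁻¹ * (h * k) ∈ G :=
    G.mul_mem (G.inv_mem (G.mul_mem hkG hhG)) (G.mul_mem hhG hkG)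
  have hyc := commute_inv_mul_of_conj_mem_zpowers hhx hkx
  obtain ⟨j, hj⟩ := hx.exists_zpow_eq_of_commute hyc
  -- The commutator of `h` and `k` acts as `x ^ j` on the support of `x` and as a commutator of two
  -- transpositions off it. Cancelling `x ^ j` leaves the square of a 3-cycle.
  have hz : x ^ (-j) * ((k * h)⁻¹ * (h * k)) =
      (swap a b * swap a c) * (swap a b * swap a c) := by
    ext1 v
    by_cases hv : v ∈ x.support
    · rw [Equiv.Perm.mul_apply, hj v hv, ← Equiv.Perm.mul_apply, ← zpow_add, neg_add_cancel,
        zpow_zero, Equiv.Perm.one_apply]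
      have ne : ∀ d, d ∉ x.support → v ≠ d := fun d hd h => hd (h ▸ hv)
      simp [swap_apply_of_ne_of_ne (ne a ha) (ne b hb), swap_apply_of_ne_of_ne (ne a ha) (ne c hc)]
    · have s1 := hswap a c ha hc v hv
      have s2 := hswap a b ha hb _ s1
      have s3 := hswap a c ha hc _ s2
      have s4 := hswap a b ha hb _ s3
      simp only [Equiv.Perm.mul_apply, mul_inv_rev]
      rw [hk v hv, hh _ s1, hinv a c ha hc k hk _ s2, hinv a b ha hb h hh _ s3]
      exact Equiv.Perm.zpow_apply_eq_self_of_apply_eq_self (by simpa using s4) _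
  refine alternatingGroup_le_of_isPreprimitive_of_isThreeCycle_mem hG
    (isThreeCycle_swap_mul_swap_same hab hac hbc).isThreeCycle_sq ?_
  rw [← hz]
  exact G.mul_mem (G.zpow_mem hxG _) hyG

/-- A transitive group generated by cycles of prime length `p` is primitive. -/
theorem isPreprimitive_closure {S : Set (Equiv.Perm α)} {p : ℕ} (hp : p.Prime)
    (hS : ∀ x ∈ S, x.IsCycle ∧ x.support.card = p)
    (htrans : MulAction.IsPretransitive (Subgroup.closure S) α) :
    MulAction.IsPreprimitive (Subgroup.closure S) α where
  isTrivialBlock_of_isBlock {B} hB := by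
    by_cases hB1 : B.Subsingleton
    · exact Or.inl hB1
    right
    rw [Set.not_subsingleton_iff] at hB1
    -- Otherwise `x` moves the block off itself and fixes none of its points. Some power `x ^ i`
    -- then carries `a` to another point `b` of `B`, so it stabilizes `B`; as `p` is prime, `x` is a
    -- power of `x ^ i` and stabilizes `B` too.
    have hgen : ∀ x ∈ S, ∀ a ∈ B, x a ∈ B := by
      intro x hxS
      by_contra! hcon
      obtain ⟨a, ha, hxa⟩ := hcon
      let g : Subgroup.closure S := ⟨x, Subgroup.subset_closure hxS⟩
      have hne : g • B ≠ B := fun h => hxa (by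
        rw [← h]
        exact Set.smul_mem_smul_set ha)
      have hdisj : _root_.Disjoint (g • B) B := hB.smul_eq_or_disjoint g |>.resolve_left hne
      have hmove : ∀ b ∈ B, x b ≠ b := fun b hb h =>
        Set.disjoint_left.1 hdisj (Set.smul_mem_smul_set hb : g • b ∈ g • B)
          (show x b ∈ B from h.symm ▸ hb)
      obtain ⟨b, hb, hba⟩ := hB1.exists_ne a
      obtain ⟨i, hi⟩ := (hS x hxS).1.sameCycle (hmove a ha) (hmove b hb)
      have hgi : g ^ i ∈ MulAction.stabilizer (Subgroup.closure S) B := by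
        rw [MulAction.mem_stabilizer_iff]
        refine (hB.smul_eq_or_disjoint (g ^ i)).resolve_right fun hd => ?_
        refine Set.disjoint_left.1 hd (Set.smul_mem_smul_set ha : g ^ i • a ∈ g ^ i • B) ?_
        have : g ^ i • a = b := hi
        rwa [this]
      have hord : orderOf g = p := by
        rw [← (hS x hxS).2, ← (hS x hxS).1.orderOf, Subgroup.orderOf_mk]
      have hcop : IsCoprime i (p : ℤ) := by
        rw [Int.isCoprime_iff_gcd_eq_one, Int.gcd_comm, ← Int.isCoprime_iff_gcd_eq_one,
          (Nat.prime_iff_prime_int.1 hp).coprime_iff_not_dvd, ← hord, orderOf_dvd_iff_zpow_eq_one]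
        intro h1
        apply hba
        have h2 : x ^ i = 1 := congrArg Subtype.val h1
        rw [← hi, h2, Equiv.Perm.one_apply]
      obtain ⟨s, t, hst⟩ := hcop
      have hg : g = (g ^ i) ^ s := by
        have hp1 : g ^ p = 1 := by rw [← hord, pow_orderOf_eq_one]
        have h1 : g ^ (t * (p : ℤ)) = 1 := by
          rw [mul_comm, zpow_mul, zpow_natCast, hp1, one_zpow]
        calc g = g ^ (s * i + t * p) := by rw [hst, zpow_one]
          _ = (g ^ i) ^ s := by rw [zpow_add, h1, mul_one, mul_comm, zpow_mul]
      apply hne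
      rw [← MulAction.mem_stabilizer_iff, hg]
      exact Subgroup.zpow_mem _ hgi s
    have hall : ∀ g ∈ Subgroup.closure S, ∀ a ∈ B, g a ∈ B := by
      intro g hg
      induction hg using Subgroup.closure_induction with
      | mem x hx => exact hgen x hx
      | one => exact fun a ha => ha
      | mul x y _ _ hx hy => exact fun a ha => hx _ (hy a ha)
      | inv x _ hx =>
        intro a ha
        have hsurj := Finset.surjOn_of_injOn_of_card_le (s := B.toFinite.toFinset)
          (t := B.toFinite.toFinset) x (fun a ha => by simpa using hx a (by simpa using ha))
          x.injective.injOn le_rfl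
        obtain ⟨b, hb, rfl⟩ := hsurj (by simpa using ha)
        rw [← Equiv.Perm.mul_apply, inv_mul_cancel]
        simpa using hb
    obtain ⟨a, ha⟩ := hB1.nonempty
    refine Set.eq_univ_of_forall fun b => ?_
    obtain ⟨g, rfl⟩ := htrans.exists_smul_eq a b
    exact hall g.1 g.2 a ha

/-- Two `p`-cycles fixing at least two points are conjugate under an even permutation. -/
theorem exists_even_conj {x y : Equiv.Perm α} (hx : x.IsCycle) (hy : y.IsCycle)
    (hxy : x.support.card = y.support.card) (hcard : x.support.card + 2 ≤ Fintype.card α) :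
    ∃ g ∈ alternatingGroup α, g * x * g⁻¹ = y := by
  obtain ⟨g, hg⟩ := isConj_iff.1 (hx.isConj hy hxy)
  rcases Int.units_eq_one_or (sign g) with h | h
  · exact ⟨g, h, hg⟩
  obtain ⟨a, ha, b, hb, hab⟩ := Finset.one_lt_card.1
    (show 1 < (x.supportᶜ).card by rw [Finset.card_compl]; omega)
  -- Swapping two fixed points of `x` corrects the sign of `g` and commutes with `x`.
  refine ⟨g * swap a b, by simp [mem_alternatingGroup, h, sign_swap hab], ?_⟩
  have hc : Commute (swap a b) x := by
    refine Disjoint.commute fun v => ?_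
    by_cases hv : x v = v
    · exact Or.inr hv
    · left
      refine swap_apply_of_ne_of_ne ?_ ?_ <;> rintro rfl <;> simp_all
  rw [← hg, mul_assoc g, hc.eq]
  group

end Equiv.Perm

/-! ### Partitions and the permutations preserving their blocks. -/

namespace Finpartition

variable {α : Type*} [Fintype α] [DecidableEq α]

theorem le_iff_forall_mem_part {P P' : Finpartition (Finset.univ : Finset α)} :
    P ≤ P' ↔ ∀ a b, a ∈ P.part b → a ∈ P'.part b := by
  constructor
  · intro h a b hab
    obtain ⟨c, hc, hsub⟩ := h (P.part_mem.2 (Finset.mem_univ b))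
    exact P'.mem_part_iff_exists.2 ⟨c, hc, hsub hab, hsub (P.mem_part (Finset.mem_univ b))⟩
  · intro h B hB
    obtain ⟨b, hb⟩ := P.nonempty_of_mem_parts hB
    refine ⟨P'.part b, P'.part_mem.2 (Finset.mem_univ b), fun a ha => h a b ?_⟩
    rwa [P.part_eq_of_mem hB hb]

theorem mem_part_comm (P : Finpartition (Finset.univ : Finset α)) {a b : α} :
    a ∈ P.part b ↔ b ∈ P.part a := by
  rw [P.mem_part_iff_part_eq_part (Finset.mem_univ a) (Finset.mem_univ b),
    P.mem_part_iff_part_eq_part (Finset.mem_univ b) (Finset.mem_univ a), eq_comm]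

theorem mem_part_trans (P : Finpartition (Finset.univ : Finset α)) {a b c : α}
    (hab : a ∈ P.part b) (hbc : b ∈ P.part c) : a ∈ P.part c := by
  rw [P.mem_part_iff_part_eq_part (Finset.mem_univ _) (Finset.mem_univ _)] at *
  exact hab.trans hbc

/-- The permutations preserving every part of a partition. -/
def preservingSubgroup (P : Finpartition (Finset.univ : Finset α)) :
    Subgroup (Equiv.Perm α) where
  carrier := {σ | ∀ a, σ a ∈ P.part a}
  one_mem' a := P.mem_part (Finset.mem_univ a)
  mul_mem' {σ τ} hσ hτ a := P.mem_part_trans (hσ (τ a)) (hτ a)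
  inv_mem' {σ} hσ a := by
    have := hσ (σ⁻¹ a)
    rw [← Equiv.Perm.mul_apply, mul_inv_cancel] at this
    exact P.mem_part_comm.1 this

theorem preservingSubgroup_mono {P P' : Finpartition (Finset.univ : Finset α)} (h : P ≤ P') :
    P.preservingSubgroup ≤ P'.preservingSubgroup :=
  fun _ hσ a => le_iff_forall_mem_part.1 h _ _ (hσ a)

end Finpartition

/-- Two points of a set with at least `k` points lie on a common cycle of length `k`. -/
theorem Equiv.Perm.exists_isCycle_support_subset {α : Type*} [Fintype α] [DecidableEq α] {k : ℕ}
    (hk : 2 ≤ k) {B : Finset α} (hB : k ≤ B.card) {a b : α} (ha : a ∈ B) (hb : b ∈ B) :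
    ∃ σ : Equiv.Perm α, σ.IsCycle ∧ σ.support.card = k ∧ σ.support ⊆ B ∧ σ.SameCycle a b := by
  obtain ⟨T, hT1, hT2, hT3⟩ := Finset.exists_subsuperset_card_eq (s := {a, b}) (t := B) (n := k)
    (by simp [Finset.insert_subset_iff, ha, hb]) (Finset.card_le_two.trans hk) hB
  obtain ⟨σ, hσ, hsup⟩ := T.exists_cycleOn
  have hnt : (T : Set α).Nontrivial := by
    rw [Finset.nontrivial_coe, ← Finset.one_lt_card_iff_nontrivial]
    omega
  have hT : σ.support = T :=
    hsup.antisymm fun v hv => Equiv.Perm.mem_support.2 (hσ.apply_ne hnt hv)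
  refine ⟨σ, Equiv.Perm.isCycle_iff_exists_isCycleOn.2 ⟨T, hnt, hσ, fun v hv => ?_⟩,
    by rw [hT, hT3], by rwa [hT], hσ.2 (hT1 (by simp)) (hT1 (by simp))⟩
  exact hsup (Equiv.Perm.mem_support.2 hv)

/-! ### Subracks of `p`-cycles and their orbit partitions. -/

section PCycleRack

variable {n p : ℕ}

/-- The permutation underlying an element of the rack of `p`-cycles. -/
def pCyclePerm (x : (pCycleRack n p).carrier) : Equiv.Perm (Fin n) := x.1.1

theorem pCyclePerm_injective : Function.Injective (pCyclePerm (n := n) (p := p)) :=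
  fun _ _ h => Subtype.ext (Subtype.ext h)

theorem pCyclePerm_act (x y : (pCycleRack n p).carrier) :
    pCyclePerm (Shelf.act x y) = pCyclePerm x * pCyclePerm y * (pCyclePerm x)⁻¹ := rfl

theorem pCyclePerm_invAct (x y : (pCycleRack n p).carrier) :
    pCyclePerm (Rack.invAct x y) = (pCyclePerm x)⁻¹ * pCyclePerm y * pCyclePerm x := by
  have := pCyclePerm_act x (Rack.invAct x y)
  rw [Rack.act_invAct_eq] at this
  rw [this]
  group

theorem isCycle_pCyclePerm (x : (pCycleRack n p).carrier) : (pCyclePerm x).IsCycle := x.2.1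

theorem card_support_pCyclePerm (x : (pCycleRack n p).carrier) :
    (pCyclePerm x).support.card = p := x.2.2

theorem exists_pCyclePerm_eq (hodd : Odd p) {σ : Equiv.Perm (Fin n)} (hσ : σ.IsCycle)
    (hp : σ.support.card = p) : ∃ x : (pCycleRack n p).carrier, pCyclePerm x = σ := by
  have hmem : σ ∈ alternatingGroup (Fin n) := by
    rw [Equiv.Perm.mem_alternatingGroup, hσ.sign, hp, hodd.neg_one_pow, neg_neg]
  exact ⟨⟨⟨σ, hmem⟩, hσ, hp⟩, rfl⟩

/-- The subrack of the `p`-cycles contained in a subgroup. -/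
def Subrack.ofSubgroup (p : ℕ) (K : Subgroup (Equiv.Perm (Fin n))) :
    Subrack (pCycleRack n p).carrier where
  carrier := {x | pCyclePerm x ∈ K}
  bijOn x hx := by
    refine ⟨fun y hy => ?_, fun y _ z _ h => (Rack.left_cancel x).1 h,
      fun y hy => ⟨Rack.invAct x y, ?_, Rack.act_invAct_eq x y⟩⟩
    · rw [Set.mem_ofPred_eq, pCyclePerm_act]
      exact K.mul_mem (K.mul_mem hx hy) (K.inv_mem hx)
    · rw [Set.mem_ofPred_eq, pCyclePerm_invAct]
      exact K.mul_mem (K.mul_mem (K.inv_mem hx) hy) hx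

namespace Subrack

/-- The permutation group generated by a subrack of `p`-cycles. -/
def generatedSubgroup (Q : Subrack (pCycleRack n p).carrier) : Subgroup (Equiv.Perm (Fin n)) :=
  Subgroup.closure (pCyclePerm '' Q.carrier)

variable {Q Q' : Subrack (pCycleRack n p).carrier}

theorem pCyclePerm_mem_generatedSubgroup {x : (pCycleRack n p).carrier} (hx : x ∈ Q.carrier) :
    pCyclePerm x ∈ Q.generatedSubgroup :=
  Subgroup.subset_closure ⟨x, hx, rfl⟩

theorem generatedSubgroup_mono (h : Q ≤ Q') : Q.generatedSubgroup ≤ Q'.generatedSubgroup :=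
  Subgroup.closure_mono (Set.image_mono h)

/-- Generators conjugate by the rack operation itself; their inverses are covered because each acts
surjectively on `Q`. -/
theorem exists_pCyclePerm_eq_conj {g : Equiv.Perm (Fin n)} (hg : g ∈ Q.generatedSubgroup) :
    ∀ y ∈ Q.carrier, ∃ z ∈ Q.carrier, pCyclePerm z = g * pCyclePerm y * g⁻¹ := by
  induction hg using Subgroup.closure_induction'' with
  | mem _ h =>
    obtain ⟨x, hx, rfl⟩ := h
    exact fun y hy => ⟨Shelf.act x y, (Q.bijOn x hx).mapsTo hy, pCyclePerm_act x y⟩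
  | inv_mem _ h =>
    obtain ⟨x, hx, rfl⟩ := h
    intro y hy
    obtain ⟨z, hz, rfl⟩ := (Q.bijOn x hx).surjOn hy
    exact ⟨z, hz, by rw [pCyclePerm_act]; group⟩
  | one => exact fun y hy => ⟨y, hy, by group⟩
  | mul g h _ _ hg hh =>
    intro y hy
    obtain ⟨z, hz, e⟩ := hh y hy
    obtain ⟨w, hw, e'⟩ := hg z hz
    exact ⟨w, hw, by rw [e', e]; group⟩

theorem eq_univ_of_isPretransitive (hp : p.Prime) (hpn : p + 2 < n)
    (h : MulAction.IsPretransitive Q.generatedSubgroup (Fin n)) : Q.carrier = Set.univ := by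
  have hprim := Equiv.Perm.isPreprimitive_closure hp (S := pCyclePerm '' Q.carrier) (by
    rintro _ ⟨x, -, rfl⟩
    exact ⟨isCycle_pCyclePerm x, card_support_pCyclePerm x⟩) h
  have hne : Q.carrier.Nonempty := by
    by_contra hne
    rw [Set.not_nonempty_iff_eq_empty] at hne
    have hbot : Q.generatedSubgroup = ⊥ := by
      rw [generatedSubgroup, hne, Set.image_empty, Subgroup.closure_empty]
    obtain ⟨g, hg⟩ := h.exists_smul_eq (⟨0, by omega⟩ : Fin n) ⟨1, by omega⟩
    have h1 : g.1 = 1 := by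
      rw [← Subgroup.mem_bot, ← hbot]
      exact g.2
    rw [Subgroup.smul_def, h1] at hg
    simp at hg
  obtain ⟨x, hx⟩ := hne
  have halt : alternatingGroup (Fin n) ≤ Q.generatedSubgroup :=
    Equiv.Perm.alternatingGroup_le_of_isPreprimitive_of_isCycle_mem hprim hp
      (isCycle_pCyclePerm x) (card_support_pCyclePerm x) (pCyclePerm_mem_generatedSubgroup hx)
      (by simpa using hpn)
  refine Set.eq_univ_of_forall fun y => ?_
  obtain ⟨g, hg, hgxy⟩ := Equiv.Perm.exists_even_conj (isCycle_pCyclePerm x) (isCycle_pCyclePerm y)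
    (by simp only [card_support_pCyclePerm]) (by
      rw [card_support_pCyclePerm, Fintype.card_fin]
      omega)
  obtain ⟨z, hz, e⟩ := exists_pCyclePerm_eq_conj (halt hg) x hx
  rwa [← pCyclePerm_injective (e.trans hgxy)]

open Classical in
/-- The partition into orbits of the group generated by a subrack. -/
noncomputable def orbitPartition (Q : Subrack (pCycleRack n p).carrier) :
    Finpartition (Finset.univ : Finset (Fin n)) :=
  Finpartition.ofSetoid (MulAction.orbitRel Q.generatedSubgroup (Fin n))

theorem mem_part_orbitPartition {a b : Fin n} :
    b ∈ Q.orbitPartition.part a ↔ ∃ g ∈ Q.generatedSubgroup, g a = b := by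
  classical
  rw [Finpartition.mem_part_comm, orbitPartition, Finpartition.mem_part_ofSetoid_iff_rel,
    MulAction.orbitRel_apply, MulAction.mem_orbit_iff]
  exact ⟨fun ⟨g, hg⟩ => ⟨g, g.2, hg⟩, fun ⟨g, hg, h⟩ => ⟨⟨g, hg⟩, h⟩⟩

/-- A point moved by some `p`-cycle of `Q` has the whole support of that cycle in its orbit; any
other point is fixed by the group. -/
theorem card_eq_one_or_le_of_mem_parts_orbitPartition {B : Finset (Fin n)}
    (hB : B ∈ Q.orbitPartition.parts) : B.card = 1 ∨ p ≤ B.card := by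
  obtain ⟨a, ha⟩ := Q.orbitPartition.nonempty_of_mem_parts hB
  have hBa := Q.orbitPartition.part_eq_of_mem hB ha
  by_cases hfix : ∀ x ∈ Q.carrier, pCyclePerm x a = a
  · left
    rw [Finset.card_eq_one]
    refine ⟨a, Finset.eq_singleton_iff_unique_mem.2 ⟨ha, fun b hb => ?_⟩⟩
    rw [← hBa, mem_part_orbitPartition] at hb
    obtain ⟨g, hg, rfl⟩ := hb
    have : Q.generatedSubgroup ≤ MulAction.stabilizer (Equiv.Perm (Fin n)) a := by
      rw [generatedSubgroup, Subgroup.closure_le]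
      rintro _ ⟨x, hx, rfl⟩
      exact hfix x hx
    exact this hg
  · right
    push Not at hfix
    obtain ⟨x, hx, hxa⟩ := hfix
    rw [← card_support_pCyclePerm x]
    refine Finset.card_le_card fun b hb => ?_
    obtain ⟨i, hi⟩ := (isCycle_pCyclePerm x).sameCycle hxa (Equiv.Perm.mem_support.1 hb)
    rw [← hBa, mem_part_orbitPartition]
    exact ⟨_, Q.generatedSubgroup.zpow_mem (pCyclePerm_mem_generatedSubgroup hx) i, hi⟩

theorem generatedSubgroup_le_preservingSubgroup :
    Q.generatedSubgroup ≤ Q.orbitPartition.preservingSubgroup :=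
  fun g hg _ => mem_part_orbitPartition.2 ⟨g, hg, rfl⟩

theorem orbitPartition_ofSubgroup (hp : p.Prime) (hodd : Odd p) (P : KEqualPartition n p) :
    (ofSubgroup p P.1.preservingSubgroup).orbitPartition = P.1 := by
  refine le_antisymm (Finpartition.le_iff_forall_mem_part.2 fun b a h => ?_)
    (Finpartition.le_iff_forall_mem_part.2 fun b a h => ?_)
  · obtain ⟨g, hg, rfl⟩ := mem_part_orbitPartition.1 h
    have : (ofSubgroup p P.1.preservingSubgroup).generatedSubgroup ≤
        P.1.preservingSubgroup := by
      rw [generatedSubgroup, Subgroup.closure_le]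
      rintro _ ⟨x, hx, rfl⟩
      exact hx
    exact this hg a
  · rw [mem_part_orbitPartition]
    have ha := P.1.mem_part (Finset.mem_univ a)
    rcases P.2 _ (P.1.part_mem.2 (Finset.mem_univ a)) with h1 | h1
    · exact ⟨1, Subgroup.one_mem _, (Finset.card_le_one.1 h1.le _ h _ ha).symm⟩
    -- A `p`-cycle inside the block joins the two points; it belongs to the rack because `p` is odd.
    · obtain ⟨σ, hσ, hσp, hsub, i, hi⟩ :=
        Equiv.Perm.exists_isCycle_support_subset hp.two_le h1 ha h
      obtain ⟨x, rfl⟩ := exists_pCyclePerm_eq hodd hσ hσp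
      refine ⟨_, Subgroup.zpow_mem _ (pCyclePerm_mem_generatedSubgroup (x := x) fun v => ?_) i, hi⟩
      by_cases hv : v ∈ (pCyclePerm x).support
      · exact P.1.mem_part_iff_exists.2 ⟨_, P.1.part_mem.2 (Finset.mem_univ a),
          hsub (Equiv.Perm.apply_mem_support.2 hv), hsub hv⟩
      · rw [Equiv.Perm.notMem_support.1 hv]
        exact P.1.mem_part (Finset.mem_univ v)

end Subrack

end PCycleRack

theorem proposition2p8 (n p : ℕ) (hp : p.Prime) (hodd : Odd p) (hpn : p + 2 < n) :
    OrderComplexesHomotopyEquivalent (Subrack (pCycleRack n p).carrier) (KEqualPartition n p) := by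
  refine OrderComplexesHomotopyEquivalent.of_closure
    (f := fun Q => ⟨Q.orbitPartition,
      fun _ => Subrack.card_eq_one_or_le_of_mem_parts_orbitPartition⟩)
    (g := fun P => Subrack.ofSubgroup p P.1.preservingSubgroup) ?_ ?_ ?_ ?_ ?_ ?_
  · intro Q Q' h
    refine Finpartition.le_iff_forall_mem_part.2 fun a b hab => ?_
    obtain ⟨g, hg, rfl⟩ := Subrack.mem_part_orbitPartition.1 hab
    exact Subrack.mem_part_orbitPartition.2 ⟨g, Subrack.generatedSubgroup_mono h hg, rfl⟩
  · exact fun P P' h x hx => Finpartition.preservingSubgroup_mono h hx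
  · exact fun P => Subtype.ext (Subrack.orbitPartition_ofSubgroup hp hodd P)
  · exact fun Q x hx => Subrack.generatedSubgroup_le_preservingSubgroup
      (Subrack.pCyclePerm_mem_generatedSubgroup hx)
  -- If the orbit partition is least, all orbits are singletons. A `p`-cycle moves a point, so `Q`
  -- is empty.
  · intro Q hQ Q' x hx
    exfalso
    obtain ⟨a, ha, -⟩ := isCycle_pCyclePerm x
    have hle : Q.orbitPartition ≤ ⊥ := hQ ⟨⊥, fun B hB => by
      obtain ⟨b, -, rfl⟩ := Finpartition.mem_bot_iff.1 hB
      exact Or.inl (Finset.card_singleton b)⟩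
    have hmem := Finpartition.le_iff_forall_mem_part.1 hle (pCyclePerm x a) a
      (Subrack.mem_part_orbitPartition.2 ⟨_, Subrack.pCyclePerm_mem_generatedSubgroup hx, rfl⟩)
    obtain ⟨B, hB, h1, h2⟩ := (Finpartition.mem_part_iff_exists _).1 hmem
    obtain ⟨b, -, rfl⟩ := Finpartition.mem_bot_iff.1 hB
    exact ha ((Finset.mem_singleton.1 h1).trans (Finset.mem_singleton.1 h2).symm)
  -- The one-block partition is admissible as `p ≤ n`, so a greatest orbit partition forces
  -- transitivity.
  · intro Q hQ Q' x _
    have hne : (Finset.univ : Finset (Fin n)) ≠ ⊥ :=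
      (Finset.univ_nonempty_iff.2 ⟨⟨0, by omega⟩⟩).ne_empty
    have hle : Finpartition.indiscrete hne ≤ Q.orbitPartition :=
      hQ ⟨Finpartition.indiscrete hne, fun B hB => by
        rw [Finpartition.indiscrete_parts, Finset.mem_singleton] at hB
        rw [hB, Finset.card_univ, Fintype.card_fin]
        omega⟩
    have huniv : Q.carrier = Set.univ := Subrack.eq_univ_of_isPretransitive hp hpn ⟨fun a b => by
      obtain ⟨g, hg, h⟩ := Subrack.mem_part_orbitPartition.1
        (Finpartition.le_iff_forall_mem_part.1 hle b a
          ((Finpartition.mem_part_iff_exists _).2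
            ⟨Finset.univ, by simp, Finset.mem_univ b, Finset.mem_univ a⟩))
      exact ⟨⟨g, hg⟩, h⟩⟩
    rw [huniv]
    exact Set.mem_univ x
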